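/- Let $\mathcal{V}$ be a cocomplete, locally small, symmetric monoidal closed category with unit object $I$. A family of maps $\{w_i : A_i \to B\}_{i\in J}$ in $\mathcal{V}$ ($J$ a small set) is called \emph{jointly regular epi} if there are small sets $R_{i,j}$ of spans $A_i \xleftarrow{x} D \xrightarrow{y} A_j$ ($i,j\in J$) such that $\{w_i\}$ is a quotient of them: $w_i\circ x = w_j\circ y$ for all $i,j$ and all spans $(x,y)$ in $R_{i,j}$, and $\{w_i\}$ is universal among families out of $\{A_i\}$ with this property (each such family $\{g_i:A_i\to X\}$ factors as $g_i=h\circ w_i$ for a unique $h:B\to X$). For small $\mathcal{V}$-categories $\mathcal{B},\mathcal{C}$, a \emph{module} $M:\mathcal{B}\nrightarrow\mathcal{C}$ consists of objects $M(c,b)$ of $\mathcal{V}$ with a left action $\mathcal{C}(c',c)\otimes M(c,b)\to M(c',b)$ and a right action $M(c,b)\otimes\mathcal{B}(b,b')\to M(c,b')$ which are unital, associative and commute with each other; a morphism of modules is a family of maps compatible with both actions. (Here composition in a $\mathcal{V}$-category is written $\mathcal{C}(a,b)\otimes\mathcal{C}(b,c)\to\mathcal{C}(a,c)$.) Modules compose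 by $(N\circ M)(d,b)=\int^{c} N(d,c)\otimes M(c,b)$ and form, with small $\mathcal{V}$-categories as objects, a bicategory $\mathcal{V}\text{-}\mathrm{Mod}$. A module is \emph{Cauchy} if it has a right adjoint in $\mathcal{V}\text{-}\mathrm{Mod}$. A module $M:\mathcal{B}\nrightarrow\mathcal{C}$ is \emph{convergent} (representable) if $M\cong\mathcal{C}(-,F-)$ for some $\mathcal{V}$-functor $F:\mathcal{B}\to\mathcal{C}$. A small $\mathcal{V}$-category $\mathcal{C}$ is \emph{Cauchy complete} if every Cauchy module from a small $\mathcal{V}$-category into $\mathcal{C}$ is convergent. Suppose that (i) for every jointly regular epi family $\{w_i:A_i\to B\}_{i\in J}$ in $\mathcal{V}$, the functions $\mathcal{V}(I,w_i):\mathcal{V}(I,A_i)\to\mathcal{V}(I,B)$ are jointly surjective; (ii) for all objects $A,B$ of $\mathcal{V}$, the function $\mathcal{V}(I,A)\times\mathcal{V}(I,B)\to\mathcal{V}(I,A\otimes B)$ sending $(a,b)$ to the composite $I\cong I\otimes I\xrightarrow{a\otimes b}A\otimes B$ is a bijection. Then every small $\mathcal{V}$-category $\mathcal{E}$ such that idempotents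 split in its underlying category $\mathcal{E}_0$ is Cauchy complete. -/

import Mathlib

open CategoryTheory MonoidalCategory Limits

universe w u

noncomputable section

section Module

variable (V : Type u) [Category.{w} V] [MonoidalCategory V]

/-- A module (profunctor, distributor) `B ⇸ C` between `V`-categories: objects `M(c, b)` of `V`
with a left action of `C` (contravariant in `c`) and a right action of `B` (covariant in `b`)
that are unital, associative and commute with each other. -/
@[ext]
structure EnrichedModule (B C : Type w) [EnrichedCategory V B] [EnrichedCategory V C] where
  obj : C → B → V
  lact (c' c : C) (b : B) : (c' ⟶[V] c) ⊗ obj c b ⟶ obj c' b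
  ract (c : C) (b b' : B) : obj c b ⊗ (b ⟶[V] b') ⟶ obj c b'
  lact_id (c : C) (b : B) : eId V c ▷ obj c b ≫ lact c c b = (λ_ (obj c b)).hom
  lact_comp (c'' c' c : C) (b : B) :
    eComp V c'' c' c ▷ obj c b ≫ lact c'' c b =
      (α_ _ _ _).hom ≫ (c'' ⟶[V] c') ◁ lact c' c b ≫ lact c'' c' b
  ract_id (c : C) (b : B) : obj c b ◁ eId V b ≫ ract c b b = (ρ_ (obj c b)).hom
  ract_comp (c : C) (b b' b'' : B) :
    obj c b ◁ eComp V b b' b'' ≫ ract c b b'' =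
      (α_ _ _ _).inv ≫ ract c b b' ▷ (b' ⟶[V] b'') ≫ ract c b' b''
  lact_ract (c' c : C) (b b' : B) :
    lact c' c b ▷ (b ⟶[V] b') ≫ ract c' b b' =
      (α_ _ _ _).hom ≫ (c' ⟶[V] c) ◁ ract c b b' ≫ lact c' c b'

variable {V}
set_option linter.unusedSectionVars false
set_option linter.unusedSimpArgs false

variable {B C D : Type w} [EnrichedCategory V B] [EnrichedCategory V C] [EnrichedCategory V D]

namespace EnrichedModule

/-- Morphisms of modules: families of maps in `V` compatible with both actions. -/
@[ext]
structure Hom (M N : EnrichedModule V B C) where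
  app (c : C) (b : B) : M.obj c b ⟶ N.obj c b
  lact_app (c' c : C) (b : B) :
    M.lact c' c b ≫ app c' b = (c' ⟶[V] c) ◁ app c b ≫ N.lact c' c b
  ract_app (c : C) (b b' : B) :
    M.ract c b b' ≫ app c b' = app c b ▷ (b ⟶[V] b') ≫ N.ract c b b'

instance : Category (EnrichedModule V B C) where
  Hom M N := Hom M N
  id M :=
    { app _ _ := 𝟙 _
      lact_app _ _ _ := by simp
      ract_app _ _ _ := by simp }
  comp f g :=
    { app c b := f.app c b ≫ g.app c b
      lact_app c' c b := by
        rw [← Category.assoc, f.lact_app, Category.assoc, g.lact_app]; simp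
      ract_app c b b' := by
        rw [← Category.assoc, f.ract_app, Category.assoc, g.ract_app]; simp }

@[simp]
theorem id_app (M : EnrichedModule V B C) (c : C) (b : B) :
    Hom.app (𝟙 M) c b = 𝟙 (M.obj c b) := rfl

@[simp]
theorem comp_app {M N P : EnrichedModule V B C} (f : M ⟶ N) (g : N ⟶ P) (c : C) (b : B) :
    Hom.app (f ≫ g) c b = Hom.app f c b ≫ Hom.app g c b := rfl

@[ext]
theorem hom_ext {M N : EnrichedModule V B C} (f g : M ⟶ N)
    (h : ∀ c b, Hom.app f c b = Hom.app g c b) : f = g :=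
  Hom.ext (funext fun c => funext fun b => h c b)

/-- A module morphism with invertible components is an isomorphism. -/
def isoMk {M N : EnrichedModule V B C} (e : ∀ c b, M.obj c b ≅ N.obj c b)
    (h₁ : ∀ c' c b, M.lact c' c b ≫ (e c' b).hom = (c' ⟶[V] c) ◁ (e c b).hom ≫ N.lact c' c b)
    (h₂ : ∀ c b b', M.ract c b b' ≫ (e c b').hom = (e c b).hom ▷ (b ⟶[V] b') ≫ N.ract c b b') :
    M ≅ N where
  hom := { app c b := (e c b).hom, lact_app := h₁, ract_app := h₂ }
  inv :=
    { app c b := (e c b).inv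
      lact_app c' c b := by
        rw [Iso.comp_inv_eq, Category.assoc, h₁]; simp
      ract_app c b b' := by
        rw [Iso.comp_inv_eq, Category.assoc, h₂]; simp }
  hom_inv_id := by ext; simp
  inv_hom_id := by ext; simp

/-- The identity module, given by the hom-objects of `C`. -/
abbrev idModule (C : Type w) [EnrichedCategory V C] : EnrichedModule V C C where
  obj c' c := c' ⟶[V] c
  lact c'' c' c := eComp V c'' c' c
  ract c b b' := eComp V c b b'
  lact_id c b := by rw [← cancel_epi (λ_ _).inv]; simp
  lact_comp _ _ _ _ := (e_assoc' V _ _ _ _).symm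
  ract_id c b := by rw [← cancel_epi (ρ_ _).inv]; simp
  ract_comp _ _ _ _ := (e_assoc V _ _ _ _).symm
  lact_ract _ _ _ _ := (e_assoc' V _ _ _ _).symm

/-- The module `F_* = C(-, F-) : B ⇸ C` induced by a `V`-functor `F : B → C`. -/
abbrev ofFunctor (F : EnrichedFunctor V B C) : EnrichedModule V B C where
  obj c b := c ⟶[V] F.obj b
  lact c' c b := eComp V c' c (F.obj b)
  ract c b b' := (c ⟶[V] F.obj b) ◁ F.map b b' ≫ eComp V c (F.obj b) (F.obj b')
  lact_id c b := by rw [← cancel_epi (λ_ _).inv]; simp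
  lact_comp _ _ _ _ := (e_assoc' V _ _ _ _).symm
  ract_id c b := by rw [← cancel_epi (ρ_ _).inv, ← whiskerLeft_comp_assoc]; simp
  ract_comp c b b' b'' := by
    rw [← whiskerLeft_comp_assoc, F.map_comp]
    simp only [whiskerLeft_comp, Category.assoc, comp_whiskerRight,
      MonoidalCategory.tensorHom_def]
    rw [← e_assoc, ← whisker_exchange_assoc]
    simp
  lact_ract c' c b b' := by
    rw [← whisker_exchange_assoc, ← e_assoc']
    simp

end EnrichedModule

/-! ### Composition of modules -/

namespace EnrichedModule

variable [HasColimits V]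

/-- The spans `N(d, c) ⊗ M(c, b) ← N(d, c) ⊗ C(c, c') ⊗ M(c', b) → N(d, c') ⊗ M(c', b)`
given by the two actions of `C`. -/
def compIndex (M : EnrichedModule V B C) (N : EnrichedModule V C D) (d : D) (b : B) :
    MultispanIndex (MultispanShape.prod C) V where
  left p := N.obj d p.1 ⊗ (p.1 ⟶[V] p.2) ⊗ M.obj p.2 b
  right c := N.obj d c ⊗ M.obj c b
  fst p := N.obj d p.1 ◁ M.lact p.1 p.2 b
  snd p := (α_ _ _ _).inv ≫ N.ract d p.1 p.2 ▷ M.obj p.2 b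

/-- The value at `(d, b)` of the composite `N ∘ M : B ⇸ D`, the coend `∫^c N(d, c) ⊗ M(c, b)`. -/
def compObj (M : EnrichedModule V B C) (N : EnrichedModule V C D) (d : D) (b : B) : V :=
  multicoequalizer (compIndex M N d b)

section Coend

variable (M : EnrichedModule V B C) (N : EnrichedModule V C D) (d : D) (b : B)

/-- The cowedge components of the coend. -/
def ι (c : C) : N.obj d c ⊗ M.obj c b ⟶ compObj M N d b :=
  Multicoequalizer.π (compIndex M N d b) c

theorem ι_condition (c c' : C) :
    N.obj d c ◁ M.lact c c' b ≫ ι M N d b c =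
      (α_ _ _ _).inv ≫ N.ract d c c' ▷ M.obj c' b ≫ ι M N d b c' := by
  have := Multicoequalizer.condition (compIndex M N d b) (c, c')
  rw [← Category.assoc]
  exact this

variable {M N d b}

/-- The universal property of the coend. -/
def desc {X : V} (k : ∀ c, N.obj d c ⊗ M.obj c b ⟶ X)
    (h : ∀ c c', N.obj d c ◁ M.lact c c' b ≫ k c =
      (α_ _ _ _).inv ≫ N.ract d c c' ▷ M.obj c' b ≫ k c') : compObj M N d b ⟶ X :=
  Multicoequalizer.desc (compIndex M N d b) X k
    (by rintro ⟨c, c'⟩; exact (h c c').trans (Category.assoc _ _ _).symm)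

@[simp]
theorem ι_desc {X : V} (k : ∀ c, N.obj d c ⊗ M.obj c b ⟶ X)
    (h : ∀ c c', N.obj d c ◁ M.lact c c' b ≫ k c =
      (α_ _ _ _).inv ≫ N.ract d c c' ▷ M.obj c' b ≫ k c') (c : C) :
    ι M N d b c ≫ desc k h = k c :=
  Multicoequalizer.π_desc _ _ _ _ _

@[simp]
theorem ι_desc_assoc {X Y : V} (k : ∀ c, N.obj d c ⊗ M.obj c b ⟶ X)
    (h : ∀ c c', N.obj d c ◁ M.lact c c' b ≫ k c =
      (α_ _ _ _).inv ≫ N.ract d c c' ▷ M.obj c' b ≫ k c') (c : C) (f : X ⟶ Y) :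
    ι M N d b c ≫ desc k h ≫ f = k c ≫ f := by
  rw [← Category.assoc, ι_desc]

theorem coend_ext {X : V} {f g : compObj M N d b ⟶ X}
    (h : ∀ c, ι M N d b c ≫ f = ι M N d b c ≫ g) : f = g :=
  Multicoequalizer.hom_ext _ _ _ h

variable [MonoidalClosed V]

/-- The functor `A ⊗ -` preserves the coend. -/
def descLeft {A X : V} (k : ∀ c, A ⊗ N.obj d c ⊗ M.obj c b ⟶ X)
    (h : ∀ c c', A ◁ N.obj d c ◁ M.lact c c' b ≫ k c =
      A ◁ (α_ _ _ _).inv ≫ A ◁ N.ract d c c' ▷ M.obj c' b ≫ k c') :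
    A ⊗ compObj M N d b ⟶ X :=
  MonoidalClosed.uncurry (desc (fun c => MonoidalClosed.curry (k c)) (fun c c' => by
    simp only [← MonoidalClosed.curry_natural_left, h]))

@[simp]
theorem ι_descLeft {A X : V} (k : ∀ c, A ⊗ N.obj d c ⊗ M.obj c b ⟶ X)
    (h : ∀ c c', A ◁ N.obj d c ◁ M.lact c c' b ≫ k c =
      A ◁ (α_ _ _ _).inv ≫ A ◁ N.ract d c c' ▷ M.obj c' b ≫ k c') (c : C) :
    A ◁ ι M N d b c ≫ descLeft k h = k c := by
  rw [descLeft, ← MonoidalClosed.uncurry_natural_left, ι_desc, MonoidalClosed.uncurry_curry]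

@[simp]
theorem ι_descLeft_assoc {A X Y : V} (k : ∀ c, A ⊗ N.obj d c ⊗ M.obj c b ⟶ X)
    (h : ∀ c c', A ◁ N.obj d c ◁ M.lact c c' b ≫ k c =
      A ◁ (α_ _ _ _).inv ≫ A ◁ N.ract d c c' ▷ M.obj c' b ≫ k c') (c : C) (f : X ⟶ Y) :
    A ◁ ι M N d b c ≫ descLeft k h ≫ f = k c ≫ f := by
  rw [← Category.assoc, ι_descLeft]

theorem coend_ext_left {A X : V} {f g : A ⊗ compObj M N d b ⟶ X}
    (h : ∀ c, A ◁ ι M N d b c ≫ f = A ◁ ι M N d b c ≫ g) : f = g := by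
  apply MonoidalClosed.curry_injective
  apply coend_ext
  intro c
  rw [← MonoidalClosed.curry_natural_left, ← MonoidalClosed.curry_natural_left, h]

variable [SymmetricCategory V]

/-- The functor `- ⊗ A` preserves the coend. -/
def descRight {A X : V} (k : ∀ c, (N.obj d c ⊗ M.obj c b) ⊗ A ⟶ X)
    (h : ∀ c c', (N.obj d c ◁ M.lact c c' b) ▷ A ≫ k c =
      (α_ _ _ _).inv ▷ A ≫ (N.ract d c c' ▷ M.obj c' b) ▷ A ≫ k c') :
    compObj M N d b ⊗ A ⟶ X :=
  (β_ _ _).hom ≫ descLeft (fun c => (β_ _ _).inv ≫ k c) (fun c c' => by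
    simp only [BraidedCategory.braiding_inv_naturality_right_assoc, h])

@[simp]
theorem ι_descRight {A X : V} (k : ∀ c, (N.obj d c ⊗ M.obj c b) ⊗ A ⟶ X)
    (h : ∀ c c', (N.obj d c ◁ M.lact c c' b) ▷ A ≫ k c =
      (α_ _ _ _).inv ▷ A ≫ (N.ract d c c' ▷ M.obj c' b) ▷ A ≫ k c') (c : C) :
    ι M N d b c ▷ A ≫ descRight k h = k c := by
  rw [descRight, BraidedCategory.braiding_naturality_left_assoc, ι_descLeft]
  simp

@[simp]
theorem ι_descRight_assoc {A X Y : V} (k : ∀ c, (N.obj d c ⊗ M.obj c b) ⊗ A ⟶ X)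
    (h : ∀ c c', (N.obj d c ◁ M.lact c c' b) ▷ A ≫ k c =
      (α_ _ _ _).inv ▷ A ≫ (N.ract d c c' ▷ M.obj c' b) ▷ A ≫ k c') (c : C) (f : X ⟶ Y) :
    ι M N d b c ▷ A ≫ descRight k h ≫ f = k c ≫ f := by
  rw [← Category.assoc, ι_descRight]

theorem coend_ext_right {A X : V} {f g : compObj M N d b ⊗ A ⟶ X}
    (h : ∀ c, ι M N d b c ▷ A ≫ f = ι M N d b c ▷ A ≫ g) : f = g := by
  rw [← cancel_epi (β_ _ _).hom]
  apply coend_ext_left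
  intro c
  rw [BraidedCategory.braiding_naturality_right_assoc, h,
    BraidedCategory.braiding_naturality_right_assoc]

end Coend

variable [MonoidalClosed V] [SymmetricCategory V]

theorem coend_ext_left_left {M : EnrichedModule V B C} {N : EnrichedModule V C D} {d : D} {b : B}
    {A A' X : V} {f g : A ⊗ A' ⊗ compObj M N d b ⟶ X}
    (h : ∀ c, A ◁ A' ◁ ι M N d b c ≫ f = A ◁ A' ◁ ι M N d b c ≫ g) : f = g := by
  rw [← cancel_epi (α_ _ _ _).hom]
  apply coend_ext_left
  intro c
  simpa using congrArg (fun t => (α_ _ _ _).hom ≫ t) (h c)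

theorem coend_ext_right_right {M : EnrichedModule V B C} {N : EnrichedModule V C D} {d : D} {b : B}
    {A A' X : V} {f g : (compObj M N d b ⊗ A) ⊗ A' ⟶ X}
    (h : ∀ c, ι M N d b c ▷ A ▷ A' ≫ f = ι M N d b c ▷ A ▷ A' ≫ g) : f = g := by
  rw [← cancel_epi (α_ _ _ _).inv]
  apply coend_ext_right
  intro c
  simpa using congrArg (fun t => (α_ _ _ _).inv ≫ t) (h c)

theorem coend_ext_left_right {M : EnrichedModule V B C} {N : EnrichedModule V C D} {d : D} {b : B}
    {A A' X : V} {f g : (A ⊗ compObj M N d b) ⊗ A' ⟶ X}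
    (h : ∀ c, (A ◁ ι M N d b c) ▷ A' ≫ f = (A ◁ ι M N d b c) ▷ A' ≫ g) : f = g := by
  rw [← cancel_epi (α_ _ _ _).inv, ← cancel_epi (A ◁ (β_ A' _).hom)]
  apply coend_ext_left_left
  intro c
  have := congrArg (fun t => A ◁ (β_ _ _).hom ≫ (α_ _ _ _).inv ≫ t) (h c)
  rw [← whiskerLeft_comp_assoc, BraidedCategory.braiding_naturality_right,
    ← whiskerLeft_comp_assoc A (A' ◁ _), BraidedCategory.braiding_naturality_right]
  simpa using this


/-- The left action on the composite of modules. -/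
def compLact (M : EnrichedModule V B C) (N : EnrichedModule V C D) (d' d : D) (b : B) :
    (d' ⟶[V] d) ⊗ compObj M N d b ⟶ compObj M N d' b :=
  descLeft (fun c => (α_ _ _ _).inv ≫ N.lact d' d c ▷ M.obj c b ≫ ι M N d' b c) (fun c c' => by
    have h₁ := congrArg (fun t => t ▷ M.obj c' b) (N.lact_ract d' d c c')
    simp only [comp_whiskerRight] at h₁
    rw [associator_inv_naturality_right_assoc, whisker_exchange_assoc, ι_condition,
      associator_inv_naturality_left_assoc, reassoc_of% h₁]
    simp)

/-- The right action on the composite of modules. -/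
def compRact (M : EnrichedModule V B C) (N : EnrichedModule V C D) (d : D) (b b' : B) :
    compObj M N d b ⊗ (b ⟶[V] b') ⟶ compObj M N d b' :=
  descRight (fun c => (α_ _ _ _).hom ≫ N.obj d c ◁ M.ract c b b' ≫ ι M N d b' c) (fun c c' => by
    have h₁ := congrArg (fun t => N.obj d c ◁ t) (M.lact_ract c c' b b')
    simp only [whiskerLeft_comp] at h₁
    rw [associator_naturality_left_assoc, ← whisker_exchange_assoc,
      associator_naturality_middle_assoc, reassoc_of% h₁, ι_condition]
    simp)

@[simp]
theorem ι_compLact (M : EnrichedModule V B C) (N : EnrichedModule V C D) (d' d : D) (b : B)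
    (c : C) :
    (d' ⟶[V] d) ◁ ι M N d b c ≫ compLact M N d' d b =
      (α_ _ _ _).inv ≫ N.lact d' d c ▷ M.obj c b ≫ ι M N d' b c :=
  ι_descLeft _ _ _

@[simp]
theorem ι_compLact_assoc (M : EnrichedModule V B C) (N : EnrichedModule V C D) (d' d : D) (b : B)
    (c : C) {X : V} (f : compObj M N d' b ⟶ X) :
    (d' ⟶[V] d) ◁ ι M N d b c ≫ compLact M N d' d b ≫ f =
      (α_ _ _ _).inv ≫ N.lact d' d c ▷ M.obj c b ≫ ι M N d' b c ≫ f := by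
  rw [← Category.assoc, ι_compLact]; simp

@[simp]
theorem ι_compRact (M : EnrichedModule V B C) (N : EnrichedModule V C D) (d : D) (b b' : B)
    (c : C) :
    ι M N d b c ▷ (b ⟶[V] b') ≫ compRact M N d b b' =
      (α_ _ _ _).hom ≫ N.obj d c ◁ M.ract c b b' ≫ ι M N d b' c :=
  ι_descRight _ _ _

@[simp]
theorem ι_compRact_assoc (M : EnrichedModule V B C) (N : EnrichedModule V C D) (d : D) (b b' : B)
    (c : C) {X : V} (f : compObj M N d b' ⟶ X) :
    ι M N d b c ▷ (b ⟶[V] b') ≫ compRact M N d b b' ≫ f =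
      (α_ _ _ _).hom ≫ N.obj d c ◁ M.ract c b b' ≫ ι M N d b' c ≫ f := by
  rw [← Category.assoc, ι_compRact]; simp

/-- The composite `N ∘ M : B ⇸ D` of modules `M : B ⇸ C` and `N : C ⇸ D`. -/
abbrev comp (M : EnrichedModule V B C) (N : EnrichedModule V C D) : EnrichedModule V B D where
  obj d b := compObj M N d b
  lact d' d b := compLact M N d' d b
  ract d b b' := compRact M N d b b'
  lact_id d b := by
    apply coend_ext_left
    intro c
    have h₁ := congrArg (fun t => t ▷ M.obj c b) (N.lact_id d c)
    simp only [comp_whiskerRight] at h₁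
    rw [whisker_exchange_assoc, ι_compLact, associator_inv_naturality_left_assoc,
      reassoc_of% h₁]
    simp
  lact_comp d'' d' d b := by
    apply coend_ext_left
    intro c
    have h₁ := congrArg (fun t => t ▷ M.obj c b) (N.lact_comp d'' d' d c)
    simp only [comp_whiskerRight] at h₁
    rw [whisker_exchange_assoc, ι_compLact, associator_inv_naturality_left_assoc,
      reassoc_of% h₁, associator_naturality_right_assoc, ← whiskerLeft_comp_assoc, ι_compLact]
    simp
  ract_id d b := by
    apply coend_ext_right
    intro c
    have h₁ := congrArg (fun t => N.obj d c ◁ t) (M.ract_id c b)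
    simp only [whiskerLeft_comp] at h₁
    rw [← whisker_exchange_assoc, ι_compRact, associator_naturality_right_assoc,
      reassoc_of% h₁]
    simp
  ract_comp d b b' b'' := by
    apply coend_ext_right
    intro c
    have h₁ := congrArg (fun t => N.obj d c ◁ t) (M.ract_comp c b b' b'')
    simp only [whiskerLeft_comp] at h₁
    rw [← whisker_exchange_assoc, ι_compRact, associator_naturality_right_assoc,
      reassoc_of% h₁, associator_inv_naturality_left_assoc, ← comp_whiskerRight_assoc, ι_compRact]
    simp
  lact_ract d' d b b' := by
    apply coend_ext_left_right
    intro c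
    rw [← comp_whiskerRight_assoc, ι_compLact, associator_naturality_middle_assoc,
      ← whiskerLeft_comp_assoc, ι_compRact]
    simp only [comp_whiskerRight, whiskerLeft_comp, Category.assoc, ι_compLact, ι_compRact]
    rw [associator_inv_naturality_right_assoc, whisker_exchange_assoc,
      associator_naturality_left_assoc]
    simp

@[simp]
theorem comp_obj (M : EnrichedModule V B C) (N : EnrichedModule V C D) (d : D) (b : B) :
    (comp M N).obj d b = compObj M N d b := rfl

@[simp]
theorem comp_lact (M : EnrichedModule V B C) (N : EnrichedModule V C D) (d' d : D) (b : B) :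
    (comp M N).lact d' d b = compLact M N d' d b := rfl

@[simp]
theorem comp_ract (M : EnrichedModule V B C) (N : EnrichedModule V C D) (d : D) (b b' : B) :
    (comp M N).ract d b b' = compRact M N d b b' := rfl

/-- Left whiskering: `M` followed by a morphism `N ⟶ N'`. -/
def whiskerL (M : EnrichedModule V B C) {N N' : EnrichedModule V C D} (f : N ⟶ N') :
    comp M N ⟶ comp M N' where
  app d b := desc (fun c => Hom.app f d c ▷ M.obj c b ≫ ι M N' d b c) (fun c c' => by
    have h₁ := congrArg (fun t => t ▷ M.obj c' b) (f.ract_app d c c')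
    simp only [comp_whiskerRight] at h₁
    rw [whisker_exchange_assoc, ι_condition, reassoc_of% h₁]
    simp)
  lact_app d' d b := by
    apply coend_ext_left
    intro c
    have h₁ := congrArg (fun t => t ▷ M.obj c b) (f.lact_app d' d c)
    simp only [comp_whiskerRight] at h₁
    simp only [comp_lact, ι_compLact_assoc, ι_desc, reassoc_of% h₁, ← whiskerLeft_comp_assoc]
    simp
  ract_app d b b' := by
    apply coend_ext_right
    intro c
    simp only [comp_ract, ι_compRact_assoc, ι_desc, ← comp_whiskerRight_assoc]
    simp [whisker_exchange_assoc]

/-- Right whiskering: a morphism `M ⟶ M'` followed by `N`. -/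
def whiskerR {M M' : EnrichedModule V B C} (f : M ⟶ M') (N : EnrichedModule V C D) :
    comp M N ⟶ comp M' N where
  app d b := desc (fun c => N.obj d c ◁ Hom.app f c b ≫ ι M' N d b c) (fun c c' => by
    have h₁ := congrArg (fun t => N.obj d c ◁ t) (f.lact_app c c' b)
    simp only [whiskerLeft_comp] at h₁
    rw [reassoc_of% h₁, ι_condition, ← whisker_exchange_assoc]
    simp)
  lact_app d' d b := by
    apply coend_ext_left
    intro c
    simp only [comp_lact, ι_compLact_assoc, ι_desc, ← whiskerLeft_comp_assoc]
    simp only [whiskerLeft_comp, Category.assoc, ι_compLact]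
    rw [associator_inv_naturality_right_assoc, whisker_exchange_assoc]
  ract_app d b b' := by
    apply coend_ext_right
    intro c
    have h₁ := congrArg (fun t => N.obj d c ◁ t) (f.ract_app c b b')
    simp only [whiskerLeft_comp] at h₁
    simp only [comp_ract, ι_compRact_assoc, ι_desc, reassoc_of% h₁, ← comp_whiskerRight_assoc]
    simp

@[simp]
theorem ι_whiskerL (M : EnrichedModule V B C) {N N' : EnrichedModule V C D} (f : N ⟶ N')
    (d : D) (b : B) (c : C) :
    ι M N d b c ≫ Hom.app (whiskerL M f) d b = Hom.app f d c ▷ M.obj c b ≫ ι M N' d b c := by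
  simp only [whiskerL, ι_desc]

@[simp]
theorem ι_whiskerR {M M' : EnrichedModule V B C} (f : M ⟶ M') (N : EnrichedModule V C D)
    (d : D) (b : B) (c : C) :
    ι M N d b c ≫ Hom.app (whiskerR f N) d b = N.obj d c ◁ Hom.app f c b ≫ ι M' N d b c := by
  simp only [whiskerR, ι_desc]

@[simp]
theorem ι_whiskerL_assoc (M : EnrichedModule V B C) {N N' : EnrichedModule V C D} (f : N ⟶ N')
    (d : D) (b : B) (c : C) {X : V} (g : compObj M N' d b ⟶ X) :
    ι M N d b c ≫ Hom.app (whiskerL M f) d b ≫ g =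
      Hom.app f d c ▷ M.obj c b ≫ ι M N' d b c ≫ g := by
  rw [← Category.assoc, ι_whiskerL, Category.assoc]

@[simp]
theorem ι_whiskerR_assoc {M M' : EnrichedModule V B C} (f : M ⟶ M') (N : EnrichedModule V C D)
    (d : D) (b : B) (c : C) {X : V} (g : compObj M' N d b ⟶ X) :
    ι M N d b c ≫ Hom.app (whiskerR f N) d b ≫ g =
      N.obj d c ◁ Hom.app f c b ≫ ι M' N d b c ≫ g := by
  rw [← Category.assoc, ι_whiskerR, Category.assoc]

/-- The left unit isomorphism, induced by the right action of `B` on `M`. -/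
def leftUnitor (M : EnrichedModule V B C) : comp (idModule B) M ≅ M :=
  isoMk
    (fun c b =>
      { hom := desc (fun b' => M.ract c b' b) (fun b' b'' => M.ract_comp c b' b'' b)
        inv := (ρ_ _).inv ≫ M.obj c b ◁ eId V b ≫ ι (idModule B) M c b b
        hom_inv_id := by
          apply coend_ext
          intro b'
          have h₁ := ι_condition (idModule B) M c b b' b
          have h₂ := congrArg (fun t => M.obj c b' ◁ t) (e_comp_id V b' b)
          simp only [whiskerLeft_comp, whiskerLeft_rightUnitor_inv, Category.assoc,
            MonoidalCategory.whiskerLeft_id] at h₂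
          rw [ι_desc_assoc, rightUnitor_inv_naturality_assoc, ← whisker_exchange_assoc,
            ← (Iso.eq_inv_comp _).1 h₁, associator_naturality_right_assoc]
          simp [reassoc_of% h₂]
        inv_hom_id := by simp [M.ract_id] })
    (fun c' c b => by
      apply coend_ext_left
      intro b'
      simp only [comp_lact, ι_compLact_assoc, ι_desc, ← whiskerLeft_comp_assoc]
      simp [M.lact_ract])
    (fun c b b' => by
      apply coend_ext_right
      intro b''
      simp only [comp_ract, ι_compRact_assoc, ι_desc, ← comp_whiskerRight_assoc]
      simp [M.ract_comp])

/-- The right unit isomorphism, induced by the left action of `C` on `M`. -/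
def rightUnitor (M : EnrichedModule V B C) : comp M (idModule C) ≅ M :=
  isoMk
    (fun c b =>
      { hom := desc (fun c' => M.lact c c' b) (fun c' c'' => by
          simp [M.lact_comp])
        inv := (λ_ _).inv ≫ eId V c ▷ M.obj c b ≫ ι M (idModule C) c b c
        hom_inv_id := by
          apply coend_ext
          intro c'
          have h₁ := ι_condition M (idModule C) c b c c'
          have h₂ := congrArg (fun t => t ▷ M.obj c' b) (e_id_comp V c c')
          simp only [comp_whiskerRight, leftUnitor_inv_whiskerRight, Category.assoc,
            MonoidalCategory.id_whiskerRight] at h₂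
          rw [ι_desc_assoc, leftUnitor_inv_naturality_assoc, whisker_exchange_assoc, h₁,
            associator_inv_naturality_left_assoc]
          simp [reassoc_of% h₂]
        inv_hom_id := by simp [M.lact_id] })
    (fun c' c b => by
      apply coend_ext_left
      intro b'
      simp only [comp_lact, ι_compLact_assoc, ι_desc, ← whiskerLeft_comp_assoc]
      simp [M.lact_comp])
    (fun c b b' => by
      apply coend_ext_right
      intro b''
      simp only [comp_ract, ι_compRact_assoc, ι_desc, ← comp_whiskerRight_assoc]
      simp [M.lact_ract])

@[simp]
theorem ι_leftUnitor_hom (M : EnrichedModule V B C) (c : C) (b b' : B) :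
    ι (idModule B) M c b b' ≫ Hom.app (leftUnitor M).hom c b = M.ract c b' b := by
  simp only [leftUnitor, isoMk, ι_desc]

@[simp]
theorem ι_rightUnitor_hom (M : EnrichedModule V B C) (c c' : C) (b : B) :
    ι M (idModule C) c b c' ≫ Hom.app (rightUnitor M).hom c b = M.lact c c' b := by
  simp only [rightUnitor, isoMk, ι_desc]

@[simp]
theorem ι_leftUnitor_hom_assoc (M : EnrichedModule V B C) (c : C) (b b' : B) {X : V}
    (f : M.obj c b ⟶ X) :
    ι (idModule B) M c b b' ≫ Hom.app (leftUnitor M).hom c b ≫ f = M.ract c b' b ≫ f := by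
  rw [← Category.assoc, ι_leftUnitor_hom]

@[simp]
theorem ι_rightUnitor_hom_assoc (M : EnrichedModule V B C) (c c' : C) (b : B) {X : V}
    (f : M.obj c b ⟶ X) :
    ι M (idModule C) c b c' ≫ Hom.app (rightUnitor M).hom c b ≫ f = M.lact c c' b ≫ f := by
  rw [← Category.assoc, ι_rightUnitor_hom]

variable {E : Type w} [EnrichedCategory V E]

/-- Components of the associator. -/
def assocHom (M : EnrichedModule V B C) (N : EnrichedModule V C D) (P : EnrichedModule V D E)
    (e : E) (b : B) : compObj (comp M N) P e b ⟶ compObj M (comp N P) e b :=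
  desc (fun d => descLeft (fun c => (α_ _ _ _).inv ≫ ι N P e c d ▷ M.obj c b ≫
      ι M (comp N P) e b c) (fun c c' => by
    have h₁ := ι_condition M (comp N P) e b c c'
    rw [associator_inv_naturality_right_assoc, whisker_exchange_assoc, h₁]
    rw [associator_inv_naturality_left_assoc, ← comp_whiskerRight_assoc, ι_compRact]
    simp)) (fun d d' => by
    apply coend_ext_left_left
    intro c
    have h₁ := congrArg (fun t => t ▷ M.obj c b) (ι_condition N P e c d d')
    simp only [comp_whiskerRight, Category.assoc] at h₁
    rw [← whiskerLeft_comp_assoc, comp_lact, ι_compLact]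
    rw [associator_inv_naturality_right_assoc, whisker_exchange_assoc, ι_descLeft]
    simp only [whiskerLeft_comp, Category.assoc, ι_descLeft]
    rw [associator_inv_naturality_middle_assoc, reassoc_of% h₁]
    simp)

/-- Components of the inverse of the associator. -/
def assocInv (M : EnrichedModule V B C) (N : EnrichedModule V C D) (P : EnrichedModule V D E)
    (e : E) (b : B) : compObj M (comp N P) e b ⟶ compObj (comp M N) P e b :=
  desc (fun c => descRight (fun d => (α_ _ _ _).hom ≫ P.obj e d ◁ ι M N d b c ≫
      ι (comp M N) P e b d) (fun d d' => by
    have h₁ := (Iso.eq_inv_comp _).1 (ι_condition (comp M N) P e b d d')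
    rw [associator_naturality_left_assoc, ← whisker_exchange_assoc, ← h₁,
      associator_naturality_right_assoc, ← whiskerLeft_comp_assoc, comp_lact, ι_compLact]
    simp)) (fun c c' => by
    rw [← cancel_epi (α_ _ _ _).hom]
    apply coend_ext_right_right
    intro d
    have h₁ := congrArg (fun t => P.obj e d ◁ t) (ι_condition M N d b c c')
    simp only [whiskerLeft_comp] at h₁
    simp only [Iso.hom_inv_id_assoc]
    rw [← comp_whiskerRight_assoc, ι_compRact]
    rw [associator_naturality_left_assoc, ← whisker_exchange_assoc, ι_descRight]
    simp only [comp_whiskerRight, Category.assoc, ι_descRight]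
    rw [associator_naturality_middle_assoc, associator_naturality_right_assoc, reassoc_of% h₁]
    simp)

section Assoc

variable (M : EnrichedModule V B C) (N : EnrichedModule V C D) (P : EnrichedModule V D E)
  (e : E) (d : D) (c : C) (b : B)

@[simp]
theorem ι_assocHom :
    P.obj e d ◁ ι M N d b c ≫ ι (comp M N) P e b d ≫ assocHom M N P e b =
      (α_ _ _ _).inv ≫ ι N P e c d ▷ M.obj c b ≫ ι M (comp N P) e b c := by
  rw [assocHom, ι_desc, ι_descLeft]

@[simp]
theorem ι_assocHom_assoc {X : V} (f : compObj M (comp N P) e b ⟶ X) :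
    P.obj e d ◁ ι M N d b c ≫ ι (comp M N) P e b d ≫ assocHom M N P e b ≫ f =
      (α_ _ _ _).inv ≫ ι N P e c d ▷ M.obj c b ≫ ι M (comp N P) e b c ≫ f := by
  have h := congrArg (fun t => t ≫ f) (ι_assocHom M N P e d c b)
  simp only [Category.assoc] at h
  exact h

@[simp]
theorem ι_assocInv :
    ι N P e c d ▷ M.obj c b ≫ ι M (comp N P) e b c ≫ assocInv M N P e b =
      (α_ _ _ _).hom ≫ P.obj e d ◁ ι M N d b c ≫ ι (comp M N) P e b d := by
  rw [assocInv, ι_desc, ι_descRight]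

@[simp]
theorem ι_assocInv_assoc {X : V} (f : compObj (comp M N) P e b ⟶ X) :
    ι N P e c d ▷ M.obj c b ≫ ι M (comp N P) e b c ≫ assocInv M N P e b ≫ f =
      (α_ _ _ _).hom ≫ P.obj e d ◁ ι M N d b c ≫ ι (comp M N) P e b d ≫ f := by
  have h := congrArg (fun t => t ≫ f) (ι_assocInv M N P e d c b)
  simp only [Category.assoc] at h
  exact h

end Assoc

/-- The associativity isomorphism of the composition of modules. -/
def assoc (M : EnrichedModule V B C) (N : EnrichedModule V C D) (P : EnrichedModule V D E) :
    comp (comp M N) P ≅ comp M (comp N P) :=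
  isoMk
    (fun e b =>
      { hom := assocHom M N P e b
        inv := assocInv M N P e b
        hom_inv_id := by
          apply coend_ext
          intro d
          apply coend_ext_left
          intro c
          simp
        inv_hom_id := by
          apply coend_ext
          intro c
          apply coend_ext_right
          intro d
          simp })
    (fun e' e b => by
      apply coend_ext_left
      intro d
      apply coend_ext_left_left
      intro c
      simp only [comp_lact, ι_compLact_assoc]
      rw [associator_inv_naturality_right_assoc, whisker_exchange_assoc, ι_assocHom]
      simp only [← whiskerLeft_comp_assoc, ι_assocHom]
      simp only [whiskerLeft_comp, Category.assoc, ι_compLact]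
      rw [associator_inv_naturality_middle_assoc, ← comp_whiskerRight_assoc]
      simp)
    (fun e b b' => by
      apply coend_ext_right
      intro d
      apply coend_ext_left_right
      intro c
      simp only [comp_ract, ι_compRact_assoc]
      rw [associator_naturality_middle_assoc]
      simp only [← whiskerLeft_comp_assoc, ι_compRact]
      simp only [whiskerLeft_comp, Category.assoc, ι_assocHom]
      simp only [← comp_whiskerRight_assoc, Category.assoc, ι_assocHom]
      simp only [comp_whiskerRight, Category.assoc, ι_compRact]
      rw [associator_naturality_left_assoc, ← whisker_exchange_assoc]
      simp)

@[simp]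
theorem assoc_hom_app (M : EnrichedModule V B C) (N : EnrichedModule V C D)
    (P : EnrichedModule V D E) (e : E) (b : B) :
    Hom.app (assoc M N P).hom e b = assocHom M N P e b := rfl

@[simp]
theorem assoc_inv_app (M : EnrichedModule V B C) (N : EnrichedModule V C D)
    (P : EnrichedModule V D E) (e : E) (b : B) :
    Hom.app (assoc M N P).inv e b = assocInv M N P e b := rfl

section Laws

theorem whiskerL_id (M : EnrichedModule V B C) (N : EnrichedModule V C D) :
    whiskerL M (𝟙 N) = 𝟙 (comp M N) := by
  ext d b
  apply coend_ext
  intro c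
  simp

theorem whiskerL_comp (M : EnrichedModule V B C) {N N' N'' : EnrichedModule V C D}
    (f : N ⟶ N') (g : N' ⟶ N'') : whiskerL M (f ≫ g) = whiskerL M f ≫ whiskerL M g := by
  ext d b
  apply coend_ext
  intro c
  simp

theorem whiskerR_id (M : EnrichedModule V B C) (N : EnrichedModule V C D) :
    whiskerR (𝟙 M) N = 𝟙 (comp M N) := by
  ext d b
  apply coend_ext
  intro c
  simp

theorem whiskerR_comp {M M' M'' : EnrichedModule V B C} (f : M ⟶ M') (g : M' ⟶ M'')
    (N : EnrichedModule V C D) : whiskerR (f ≫ g) N = whiskerR f N ≫ whiskerR g N := by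
  ext d b
  apply coend_ext
  intro c
  simp

theorem id_whiskerL {M N : EnrichedModule V B C} (f : M ⟶ N) :
    whiskerL (idModule B) f ≫ (leftUnitor N).hom = (leftUnitor M).hom ≫ f := by
  ext c b
  apply coend_ext
  intro b'
  simp [← f.ract_app]

theorem whiskerR_idModule {M N : EnrichedModule V B C} (f : M ⟶ N) :
    whiskerR f (idModule C) ≫ (rightUnitor N).hom = (rightUnitor M).hom ≫ f := by
  ext c b
  apply coend_ext
  intro c'
  simp [← f.lact_app]

theorem comp_whiskerL (M : EnrichedModule V B C) (N : EnrichedModule V C D)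
    {P P' : EnrichedModule V D E} (f : P ⟶ P') :
    whiskerL (comp M N) f ≫ (assoc M N P').hom =
      (assoc M N P).hom ≫ whiskerL M (whiskerL N f) := by
  ext e b
  apply coend_ext
  intro d
  apply coend_ext_left
  intro c
  simp only [comp_app, assoc_hom_app, ι_whiskerL_assoc, ι_assocHom_assoc, ι_whiskerL]
  rw [whisker_exchange_assoc, ι_assocHom, ← comp_whiskerRight_assoc, ι_whiskerL]
  simp

theorem whiskerR_whiskerR {M M' : EnrichedModule V B C} (f : M ⟶ M') (N : EnrichedModule V C D)
    (P : EnrichedModule V D E) :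
    whiskerR (whiskerR f N) P ≫ (assoc M' N P).hom =
      (assoc M N P).hom ≫ whiskerR f (comp N P) := by
  ext e b
  apply coend_ext
  intro d
  apply coend_ext_left
  intro c
  simp only [comp_app, assoc_hom_app, ι_whiskerR_assoc, ι_assocHom_assoc, ι_whiskerR]
  rw [← whiskerLeft_comp_assoc, ι_whiskerR, whiskerLeft_comp_assoc, ι_assocHom,
    associator_inv_naturality_right_assoc, whisker_exchange_assoc]

theorem whisker_assoc (M : EnrichedModule V B C) {N N' : EnrichedModule V C D} (f : N ⟶ N')
    (P : EnrichedModule V D E) :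
    whiskerR (whiskerL M f) P ≫ (assoc M N' P).hom =
      (assoc M N P).hom ≫ whiskerL M (whiskerR f P) := by
  ext e b
  apply coend_ext
  intro d
  apply coend_ext_left
  intro c
  simp only [comp_app, assoc_hom_app, ι_whiskerR_assoc, ι_assocHom_assoc, ι_whiskerL]
  rw [← whiskerLeft_comp_assoc, ι_whiskerL, whiskerLeft_comp_assoc, ι_assocHom,
    ← comp_whiskerRight_assoc, ι_whiskerR]
  simp

theorem whisker_exch {M M' : EnrichedModule V B C} {N N' : EnrichedModule V C D}
    (f : M ⟶ M') (g : N ⟶ N') :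
    whiskerL M g ≫ whiskerR f N' = whiskerR f N ≫ whiskerL M' g := by
  ext d b
  apply coend_ext
  intro c
  simp [whisker_exchange_assoc]

theorem pentagon {F : Type w} [EnrichedCategory V F] (M : EnrichedModule V B C)
    (N : EnrichedModule V C D) (P : EnrichedModule V D E) (Q : EnrichedModule V E F) :
    whiskerR (assoc M N P).hom Q ≫ (assoc M (comp N P) Q).hom ≫ whiskerL M (assoc N P Q).hom =
      (assoc (comp M N) P Q).hom ≫ (assoc M N (comp P Q)).hom := by
  ext x b
  apply coend_ext
  intro e
  apply coend_ext_left
  intro d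
  apply coend_ext_left_left
  intro c
  simp only [comp_app, assoc_hom_app, ι_whiskerR_assoc, ι_assocHom_assoc, ι_whiskerL]
  rw [← whiskerLeft_comp_assoc, ← whiskerLeft_comp_assoc, Category.assoc, ι_assocHom]
  simp only [whiskerLeft_comp, Category.assoc, ι_assocHom_assoc, ι_whiskerL]
  have h := ι_assocHom M N (comp P Q) x d c b
  simp only [comp_obj] at h
  rw [associator_inv_naturality_right_assoc, whisker_exchange_assoc, h,
    associator_inv_naturality_middle_assoc, ← comp_whiskerRight_assoc _ _ (M.obj c b),
    ← comp_whiskerRight_assoc _ _ (M.obj c b)]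
  simp

theorem triangle (M : EnrichedModule V B C) (N : EnrichedModule V C D) :
    (assoc M (idModule C) N).hom ≫ whiskerL M (leftUnitor N).hom =
      whiskerR (rightUnitor M).hom N := by
  ext d b
  apply coend_ext
  intro c'
  apply coend_ext_left
  intro c
  simp only [comp_app, assoc_hom_app, ι_whiskerR, ι_assocHom_assoc, ι_whiskerL]
  rw [← comp_whiskerRight_assoc, ι_leftUnitor_hom, ← whiskerLeft_comp_assoc, ι_rightUnitor_hom]
  rw [ι_condition]

end Laws

end EnrichedModule

end Module

/-- The objects of the bicategory `V`-Mod: small `V`-categories. -/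
structure VMod (V : Type u) [Category.{w} V] [MonoidalCategory V] where
  carrier : Type w
  [enriched : EnrichedCategory V carrier]

attribute [instance] VMod.enriched

namespace VMod

variable {V : Type u} [Category.{w} V] [MonoidalCategory V] [MonoidalClosed V]
  [SymmetricCategory V] [HasColimits V]

open EnrichedModule

/-- The bicategory `V`-Mod of small `V`-categories, modules and module morphisms. -/
instance : Bicategory (VMod.{w} V) where
  Hom B C := EnrichedModule V B.carrier C.carrier
  id B := idModule B.carrier
  comp M N := EnrichedModule.comp M N
  homCategory B C := inferInstanceAs (Category (EnrichedModule V B.carrier C.carrier))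
  whiskerLeft M _ _ f := whiskerL M f
  whiskerRight f N := whiskerR f N
  associator M N P := assoc M N P
  leftUnitor M := EnrichedModule.leftUnitor M
  rightUnitor M := EnrichedModule.rightUnitor M
  whiskerLeft_id M N := whiskerL_id M N
  whiskerLeft_comp M _ _ _ f g := whiskerL_comp M f g
  id_whiskerLeft f := by
    rw [← Category.assoc, Iso.eq_comp_inv]
    exact id_whiskerL f
  comp_whiskerLeft M N _ _ f := by
    rw [← Category.assoc, Iso.eq_comp_inv]
    exact comp_whiskerL M N f
  id_whiskerRight M N := whiskerR_id M N
  comp_whiskerRight f g N := whiskerR_comp f g N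
  whiskerRight_id f := by
    rw [← Category.assoc, Iso.eq_comp_inv]
    exact whiskerR_idModule f
  whiskerRight_comp f N P := by
    rw [Iso.eq_inv_comp]
    exact (whiskerR_whiskerR f N P).symm
  whisker_assoc M _ _ f P := by
    rw [← Category.assoc, Iso.eq_comp_inv]
    exact EnrichedModule.whisker_assoc M f P
  whisker_exchange f g := whisker_exch f g
  pentagon M N P Q := EnrichedModule.pentagon M N P Q
  triangle M N := EnrichedModule.triangle M N

end VMod

section CauchyComplete

variable {V : Type u} [Category.{w} V] [MonoidalCategory V] [MonoidalClosed V]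
  [SymmetricCategory V] [HasColimits V]

/-- A module is Cauchy if it has a right adjoint in the bicategory `V`-Mod. -/
def EnrichedModule.IsCauchy {B C : Type w} [EnrichedCategory V B] [EnrichedCategory V C]
    (M : EnrichedModule V B C) : Prop :=
  Bicategory.IsLeftAdjoint (B := VMod.{w} V) (a := ⟨B⟩) (b := ⟨C⟩) M

/-- A module `M : B ⇸ C` is convergent if `M ≅ C(-, F-)` for some `V`-functor `F : B → C`.
If `B` is the unit `V`-category, this says that `M` is represented by an object of `C`. -/
def EnrichedModule.IsConvergent {B C : Type w} [EnrichedCategory V B] [EnrichedCategory V C]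
    (M : EnrichedModule V B C) : Prop :=
  ∃ F : EnrichedFunctor V B C, Nonempty (M ≅ EnrichedModule.ofFunctor F)

variable (V) in
/-- A small `V`-category is Cauchy complete if all Cauchy modules into it are convergent. -/
def CauchyComplete (C : Type w) [EnrichedCategory V C] : Prop :=
  ∀ (B : Type w) [EnrichedCategory V B] (M : EnrichedModule V B C), M.IsCauchy → M.IsConvergent

end CauchyComplete

section RegularEpi

variable {V : Type u} [Category.{w} V] {J : Type w}

/-- A relation on a family of objects: for all `i` and `j`, a (small) set of spans
`A i ← D → A j`. -/
structure FamilyRelation (A : J → V) where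
  spans (i j : J) : Set (Σ D : V, (D ⟶ A i) × (D ⟶ A j))
  small (i j : J) : Small.{w} (spans i j)

/-- The family coequalizes all spans of the relation. -/
def FamilyRelation.IsCompatible {A : J → V} (R : FamilyRelation A) {B : V}
    (f : ∀ j, A j ⟶ B) : Prop :=
  ∀ i j, ∀ s ∈ R.spans i j, s.2.1 ≫ f i = s.2.2 ≫ f j

/-- The family is a quotient of the relation: a universal compatible family. -/
def FamilyRelation.IsQuotient {A : J → V} (R : FamilyRelation A) {B : V}
    (f : ∀ j, A j ⟶ B) : Prop :=
  R.IsCompatible f ∧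
    ∀ (X : V) (g : ∀ j, A j ⟶ X), R.IsCompatible g → ∃! h : B ⟶ X, ∀ j, f j ≫ h = g j

/-- A family of maps is jointly regular epi if it is a quotient of some relation. -/
def JointlyRegularEpi {A : J → V} {B : V} (f : ∀ j, A j ⟶ B) : Prop :=
  ∃ R : FamilyRelation A, R.IsQuotient f

end RegularEpi

end

/-! Let `M : B ⇸ E` have right adjoint `N`, with unit `η` and counit `ε`, and fix an object `b`. The
identity of `b` is sent by `η` to an element, that is, a map out of the unit object, of the coend
`∫^c N(b, c) ⊗ M(c, b)`. The coend inclusions are jointly regular epi (`jointlyRegularEpi_ι`), so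
hypothesis (i) lifts this element to a single `N(b, c) ⊗ M(c, b)`, and hypothesis (ii) writes the
lift as `n ⊗ m` with `n` an element of `N(b, c)` and `m` an element of `M(c, b)`.

By Yoneda, `m` is a map `E(-, c) ⟶ M(-, b)`; pairing with `n` and applying `ε` is a map `M(-, b) ⟶
E(-, c)`. A triangle identity, evaluated at the identity of `b`, says that `M(-, b) ⟶ E(-, c) ⟶ M(-,
b)` is the identity (`pairing_yonedaMap`). Thus `M(-, b)` is a retract of a representable. The
resulting idempotent on `E(-, c)` comes from an idempotent on `c` in the underlying category of `E`,
and an object splitting it represents `M(-, b)` (`exists_isIso_yonedaMap_of_retract`).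

Finally, representing objects chosen separately for each `b` assemble into a `V`-functor, because
the right action of `B` transports along the representing isomorphisms
(`isConvergent_of_isIso_yonedaMap`). -/

namespace CategoryTheory.Bicategory

/-- Moving the right unitor to the left-hand side gives a form without inverse unitors, which can be
evaluated on coend inclusions. -/
theorem left_triangle_rightUnitor {B : Type*} [Bicategory B] {a b : B} {f : a ⟶ b} {g : b ⟶ a}
    (adj : Adjunction f g) :
    whiskerRight adj.unit f ≫ (associator f g f).hom ≫ whiskerLeft f adj.counit ≫
      (rightUnitor f).hom = (leftUnitor f).hom := by
  have h := adj.left_triangle =≫ (rightUnitor f).hom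
  simpa [leftZigzag, bicategoricalComp] using h

end CategoryTheory.Bicategory

noncomputable section

namespace EnrichedModule

variable {V : Type u} [Category.{w} V] [MonoidalCategory V]

/-! ### Yoneda for elements of modules -/

section Yoneda

variable {B C : Type w} [EnrichedCategory V B] [EnrichedCategory V C]

/-- The map `C(-, c₀) ⟶ M(-, b)` corresponding to an element `m` of `M(c₀, b)`. -/
def yonedaMap (M : EnrichedModule V B C) {c₀ : C} {b : B} (m : 𝟙_ V ⟶ M.obj c₀ b) (c : C) :
    (c ⟶[V] c₀) ⟶ M.obj c b :=
  (ρ_ _).inv ≫ (c ⟶[V] c₀) ◁ m ≫ M.lact c c₀ b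

/-- Associativity of the left action makes acting on a fixed element a left-module map. -/
theorem eComp_yonedaMap (M : EnrichedModule V B C) {c₀ : C} {b : B} (m : 𝟙_ V ⟶ M.obj c₀ b)
    (c' c : C) :
    eComp V c' c c₀ ≫ yonedaMap M m c' =
      (c' ⟶[V] c) ◁ yonedaMap M m c ≫ M.lact c' c b := by
  simp only [yonedaMap, rightUnitor_inv_naturality_assoc, whiskerLeft_comp, Category.assoc]
  rw [← whisker_exchange_assoc, M.lact_comp]
  simp

theorem eId_yonedaMap (M : EnrichedModule V B C) {c₀ : C} {b : B} (m : 𝟙_ V ⟶ M.obj c₀ b) :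
    eId V c₀ ≫ yonedaMap M m c₀ = m := by
  simp only [yonedaMap, rightUnitor_inv_naturality_assoc]
  rw [← whisker_exchange_assoc, M.lact_id]
  simp [unitors_equal]

/-- A family of maps compatible with the left actions commutes with Yoneda maps. -/
theorem yonedaMap_comp {B' : Type w} [EnrichedCategory V B'] (M : EnrichedModule V B C)
    (N : EnrichedModule V B' C) {b : B} {b' : B'} (s : ∀ c, M.obj c b ⟶ N.obj c b')
    (hs : ∀ c' c, M.lact c' c b ≫ s c' = (c' ⟶[V] c) ◁ s c ≫ N.lact c' c b')
    {c₀ : C} (m : 𝟙_ V ⟶ M.obj c₀ b) (c : C) :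
    yonedaMap M m c ≫ s c = yonedaMap N (m ≫ s c₀) c := by
  simp [yonedaMap, hs]

/-- A Yoneda map is itself compatible with left actions, so this is an instance of `yonedaMap_comp`.
It reduces composites of maps between representables to composites of elements. -/
theorem yonedaMap_comp_yonedaMap (M : EnrichedModule V B C) {c₀ c₁ : C} {b : B}
    (i : 𝟙_ V ⟶ (c₀ ⟶[V] c₁)) (m : 𝟙_ V ⟶ M.obj c₁ b) (c : C) :
    yonedaMap (idModule C) i c ≫ yonedaMap M m c = yonedaMap M (i ≫ yonedaMap M m c₀) c :=
  yonedaMap_comp (idModule C) M (yonedaMap M m) (eComp_yonedaMap M m) i c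

theorem yonedaMap_eId (c₀ c : C) : yonedaMap (idModule C) (eId V c₀) c = 𝟙 (c ⟶[V] c₀) :=
  e_comp_id V c c₀

/-- Dictionary with the underlying category: the right-hand side is the composition of
`ForgetEnrichment V C`. -/
theorem comp_yonedaMap_idModule {c₀ c₁ c₂ : C} (f : 𝟙_ V ⟶ (c₀ ⟶[V] c₁))
    (g : 𝟙_ V ⟶ (c₁ ⟶[V] c₂)) :
    f ≫ yonedaMap (idModule C) g c₀ = (λ_ _).inv ≫ (f ⊗ₘ g) ≫ eComp V c₀ c₁ c₂ := by
  simp [yonedaMap, MonoidalCategory.tensorHom_def, unitors_inv_equal]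

end Yoneda

/-! ### From pointwise representability to a `V`-functor -/

section Representable

variable {B C : Type w} [EnrichedCategory V B] [EnrichedCategory V C]
  (M : EnrichedModule V B C) (F : B → C) (u : ∀ b, 𝟙_ V ⟶ M.obj (F b) b)
  [∀ b c, IsIso (yonedaMap M (u b) c)]

/-- The action on hom-objects of the functor representing a pointwise representable module. -/
def representingMap (b b' : B) : (b ⟶[V] b') ⟶ (F b ⟶[V] F b') :=
  (λ_ _).inv ≫ u b ▷ (b ⟶[V] b') ≫ M.ract (F b) b b' ≫ inv (yonedaMap M (u b') (F b))

/-- The equation `F(f) · u b' = u b · f`. As the Yoneda map of `u b'` is invertible, it determines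
the action on homs. -/
theorem representingMap_yonedaMap (b b' : B) :
    representingMap M F u b b' ≫ yonedaMap M (u b') (F b) =
      (λ_ _).inv ≫ u b ▷ (b ⟶[V] b') ≫ M.ract (F b) b b' := by
  simp [representingMap]

/-- The Yoneda maps respect the right actions, because the two actions on `M` commute. This serves
twice: at `c = F b` it proves that the representing map preserves composition, and for all `c` it
makes the Yoneda maps an isomorphism of modules. -/
theorem yonedaMap_ract (c : C) (b b' : B) :
    ((c ⟶[V] F b) ◁ representingMap M F u b b' ≫ eComp V c (F b) (F b')) ≫
        yonedaMap M (u b') c =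
      yonedaMap M (u b) c ▷ (b ⟶[V] b') ≫ M.ract c b b' := by
  rw [Category.assoc, eComp_yonedaMap, ← whiskerLeft_comp_assoc, representingMap_yonedaMap]
  simp only [yonedaMap, comp_whiskerRight, Category.assoc, M.lact_ract]
  simp

/-- The functor representing a pointwise representable module. -/
def representingFunctor : EnrichedFunctor V B C where
  obj := F
  map := representingMap M F u
  map_id b := by
    -- Both functor laws are tested after an invertible Yoneda map, where they become unitality and
    -- associativity of the right action on `u`.
    rw [← cancel_mono (yonedaMap M (u b) (F b)), Category.assoc, representingMap_yonedaMap,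
      eId_yonedaMap, leftUnitor_inv_naturality_assoc, whisker_exchange_assoc, M.ract_id]
    simp [unitors_inv_equal]
  map_comp b b' b'' := by
    rw [← cancel_mono (yonedaMap M (u b'') (F b)), Category.assoc, representingMap_yonedaMap,
      MonoidalCategory.tensorHom_def, Category.assoc, Category.assoc]
    have h := yonedaMap_ract M F u (F b) b' b''
    rw [Category.assoc] at h
    rw [h, ← comp_whiskerRight_assoc, representingMap_yonedaMap,
      leftUnitor_inv_naturality_assoc, whisker_exchange_assoc, M.ract_comp]
    simp

end Representable

theorem isConvergent_of_isIso_yonedaMap {B C : Type w} [EnrichedCategory V B]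
    [EnrichedCategory V C] [HasColimits V] [MonoidalClosed V] [SymmetricCategory V]
    (M : EnrichedModule V B C) (F : B → C) (u : ∀ b, 𝟙_ V ⟶ M.obj (F b) b)
    (hu : ∀ b c, IsIso (yonedaMap M (u b) c)) : M.IsConvergent :=
  ⟨representingFunctor M F u, ⟨(isoMk (M := ofFunctor (representingFunctor M F u)) (N := M)
    (fun c b => @asIso _ _ _ _ (yonedaMap M (u b) c) (hu b c))
    (fun c' c b => eComp_yonedaMap M (u b) c' c)
    (fun c b b' => yonedaMap_ract M F u c b b')).symm⟩⟩

/-- If `M(-, b)` is a retract of `C(-, c)` and idempotents split in the underlying category of `C`,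
then `M(-, b)` is representable. -/
theorem exists_isIso_yonedaMap_of_retract {B C : Type w} [EnrichedCategory V B]
    [EnrichedCategory V C] (hsplit : IsIdempotentComplete (ForgetEnrichment V C))
    (M : EnrichedModule V B C) {b : B} {c : C} (m : 𝟙_ V ⟶ M.obj c b)
    (s : ∀ c', M.obj c' b ⟶ (c' ⟶[V] c))
    (hs : ∀ c'' c', M.lact c'' c' b ≫ s c'' = (c'' ⟶[V] c') ◁ s c' ≫ eComp V c'' c' c)
    (hsm : ∀ c', s c' ≫ yonedaMap M m c' = 𝟙 _) :
    ∃ (c₀ : C) (u : 𝟙_ V ⟶ M.obj c₀ b), ∀ c', IsIso (yonedaMap M u c') := by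
  -- The idempotent on `c` is `e = m ≫ s c`: the composite `E(-, c) ⟶ M(-, b) ⟶ E(-, c)` is the
  -- Yoneda map of `e`, here with `C` in place of `E`.
  have hms : ∀ c', yonedaMap M m c' ≫ s c' = yonedaMap (idModule C) (m ≫ s c) c' :=
    yonedaMap_comp M (idModule C) s hs m
  have hidem : (m ≫ s c) ≫ yonedaMap (idModule C) (m ≫ s c) c = m ≫ s c := by
    rw [← hms, Category.assoc, reassoc_of% hsm]
  rw [comp_yonedaMap_idModule] at hidem
  obtain ⟨c₀, i, p, hip, hpi⟩ := hsplit.idempotents_split (ForgetEnrichment.of V c)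
    (ForgetEnrichment.homOf V (m ≫ s c))
    ((ForgetEnrichment.homOf_comp V _ _).symm.trans (congrArg (ForgetEnrichment.homOf V) hidem))
  obtain ⟨c₀, rfl⟩ : ∃ c₁, ForgetEnrichment.of V c₁ = c₀ := ⟨c₀, rfl⟩
  obtain ⟨i, rfl⟩ : ∃ i', ForgetEnrichment.homOf V i' = i := ⟨i, rfl⟩
  obtain ⟨p, rfl⟩ : ∃ p', ForgetEnrichment.homOf V p' = p := ⟨p, rfl⟩
  rw [← ForgetEnrichment.homOf_comp, ← comp_yonedaMap_idModule] at hip hpi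
  replace hip : i ≫ yonedaMap (idModule C) p c₀ = eId V c₀ :=
    hip.trans (ForgetEnrichment.homOf_eId V c₀).symm
  replace hpi : p ≫ yonedaMap (idModule C) i c = m ≫ s c := hpi
  -- With `e` split as `p` followed by `i`, the universal element is `m` restricted along `i`; the
  -- inverse of its Yoneda map is `s` followed by postcomposition with `p`.
  refine ⟨c₀, i ≫ yonedaMap M m c₀, fun c' => ⟨s c' ≫ yonedaMap (idModule C) p c', ?_, ?_⟩⟩
  · have hiep : i ≫ yonedaMap (idModule C) (m ≫ s c) c₀ = i := by
      rw [← hpi, ← yonedaMap_comp_yonedaMap, reassoc_of% hip, eId_yonedaMap]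
    rw [← yonedaMap_comp_yonedaMap, Category.assoc, reassoc_of% hms c',
      ← Category.assoc, yonedaMap_comp_yonedaMap, hiep, yonedaMap_comp_yonedaMap, hip,
      yonedaMap_eId]
  · rw [← yonedaMap_comp_yonedaMap, Category.assoc,
      reassoc_of% yonedaMap_comp_yonedaMap (idModule C) p i c', hpi, ← hms, Category.assoc, hsm, Category.comp_id, hsm]

/-! ### The retraction extracted from an adjunction of modules -/

section Cauchy

variable [HasColimits V]

/-- The coend inclusions form a jointly regular epi family. -/
theorem jointlyRegularEpi_ι {B C D : Type w} [EnrichedCategory V B] [EnrichedCategory V C]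
    [EnrichedCategory V D] (M : EnrichedModule V B C) (N : EnrichedModule V C D) (d : D) (b : B) :
    JointlyRegularEpi (ι M N d b) := by
  refine ⟨⟨fun c c' => {⟨N.obj d c ⊗ (c ⟶[V] c') ⊗ M.obj c' b, N.obj d c ◁ M.lact c c' b,
    (α_ _ _ _).inv ≫ N.ract d c c' ▷ M.obj c' b⟩}, fun _ _ => inferInstance⟩, ?_, ?_⟩
  · rintro c c' _ rfl
    simpa using ι_condition M N d b c c'
  · intro X g hg
    have h (c c' : C) := hg c c' _ rfl
    refine ⟨desc g fun c c' => by simpa using h c c', fun c => ι_desc _ _ c, fun k hk => ?_⟩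
    exact coend_ext fun c => by rw [hk, ι_desc]

variable [MonoidalClosed V] [SymmetricCategory V]

variable {B C : Type w} [EnrichedCategory V B] [EnrichedCategory V C]
  {M : EnrichedModule V B C} {N : EnrichedModule V C B}

/-- The map `M(-, b) ⟶ C(-, c)` obtained by pairing with an element of `N(b, c)`. -/
def pairing (ε : comp N M ⟶ idModule C) {b : B} {c : C} (n : 𝟙_ V ⟶ N.obj b c) (c' : C) :
    M.obj c' b ⟶ (c' ⟶[V] c) :=
  (ρ_ _).inv ≫ M.obj c' b ◁ n ≫ ι N M c' c b ≫ Hom.app ε c' c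

/-- The left action on the coend moves only the `M` factor, and `ε` respects left actions. -/
theorem lact_pairing (ε : comp N M ⟶ idModule C) {b : B} {c : C} (n : 𝟙_ V ⟶ N.obj b c)
    (c'' c' : C) :
    M.lact c'' c' b ≫ pairing ε n c'' =
      (c'' ⟶[V] c') ◁ pairing ε n c' ≫ eComp V c'' c' c := by
  have h := ε.lact_app c'' c' c
  simp only [pairing, whiskerLeft_comp, Category.assoc]
  rw [← h, comp_lact, ι_compLact_assoc, rightUnitor_inv_naturality_assoc,
    ← whisker_exchange_assoc]
  simp

/-- Hypothesis `h` says that `n ⊗ m` represents the image of the identity of `b` under `η`.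
Substituting it into the triangle identity leaves exactly the pairing with `n` followed by the
action on `m`. -/
theorem pairing_yonedaMap (η : idModule B ⟶ comp M N) (ε : comp N M ⟶ idModule C)
    (htri : whiskerR η M ≫ (assoc M N M).hom ≫ whiskerL M ε ≫ (rightUnitor M).hom =
      (leftUnitor M).hom) {b : B} {c : C} (n : 𝟙_ V ⟶ N.obj b c) (m : 𝟙_ V ⟶ M.obj c b)
    (h : ((ρ_ (𝟙_ V)).inv ≫ (n ⊗ₘ m)) ≫ ι M N b b c = eId V b ≫ Hom.app η b b) (c' : C) :
    pairing ε n c' ≫ yonedaMap M m c' = 𝟙 _ := by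
  -- The prefix inserts the identity of `b`; it is the inverse of the left unitor, so the right-hand
  -- side becomes the identity.
  have ht := congrArg (fun t => (ρ_ _).inv ≫ M.obj c' b ◁ eId V b ≫ ι (idModule B) M c' b b ≫
    Hom.app t c' b) htri
  simp only [comp_app, assoc_hom_app, ι_leftUnitor_hom, M.ract_id, Iso.inv_hom_id,
    ι_whiskerR_assoc] at ht
  rw [← whiskerLeft_comp_assoc, ← h] at ht
  simp only [whiskerLeft_comp, Category.assoc, ι_assocHom_assoc, ι_whiskerL_assoc,
    ι_rightUnitor_hom] at ht
  rw [← ht]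
  -- What remains is coherence: `m` slides past `n`, the coend inclusion and the counit.
  simp only [pairing, yonedaMap, MonoidalCategory.tensorHom_def', whiskerLeft_comp, Category.assoc]
  simp only [rightUnitor_inv_naturality_assoc, whisker_exchange_assoc,
    associator_inv_naturality_middle_assoc, associator_inv_naturality_right_assoc]
  simp

/-- The bicategory structure on `VMod` is built from these operations, so the abstract identity is
this one after unfolding. The named arguments record that the identity 1-cells are `idModule`. -/
theorem left_triangle_of_adjunction
    (adj : Bicategory.Adjunction (B := VMod.{w} V) (a := ⟨B⟩) (b := ⟨C⟩) M N) :
    whiskerR (M := idModule B) adj.unit M ≫ (assoc M N M).hom ≫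
      whiskerL (N' := idModule C) M adj.counit ≫ (rightUnitor M).hom = (leftUnitor M).hom :=
  Bicategory.left_triangle_rightUnitor adj

end Cauchy

end EnrichedModule

end

open EnrichedModule in
theorem mainTheorem2 {V : Type u} [Category.{w} V] [HasColimits V] [MonoidalCategory V]
    [SymmetricCategory V] [MonoidalClosed V]
    (hregular : ∀ (J : Type w) (A : J → V) (B : V) (f : ∀ j, A j ⟶ B), JointlyRegularEpi f →
      ∀ x : 𝟙_ V ⟶ B, ∃ (j : J) (y : 𝟙_ V ⟶ A j), y ≫ f j = x)
    (htensor : ∀ A B : V, Function.Bijective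
      (fun p : (𝟙_ V ⟶ A) × (𝟙_ V ⟶ B) => (ρ_ (𝟙_ V)).inv ≫ (p.1 ⊗ₘ p.2)))
    (E : Type w) [EnrichedCategory V E]
    (hsplit : IsIdempotentComplete (ForgetEnrichment V E)) :
    CauchyComplete V E := by
  rintro B _ M ⟨⟨N, adj⟩⟩
  have key (b : B) : ∃ (c₀ : E) (u : 𝟙_ V ⟶ M.obj c₀ b), ∀ c', IsIso (yonedaMap M u c') := by
    -- The element lifted is the image under the unit of the identity of `b`.
    obtain ⟨c, y, hy⟩ := hregular E _ _ _ (jointlyRegularEpi_ι M N b b)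
      (eId V b ≫ Hom.app (M := idModule B) (N := comp M N) adj.unit b b)
    obtain ⟨⟨n, m⟩, rfl⟩ := (htensor _ _).2 y
    exact exists_isIso_yonedaMap_of_retract hsplit M m (pairing adj.counit n)
      (lact_pairing adj.counit n)
      (pairing_yonedaMap _ _ (left_triangle_of_adjunction adj) n m hy)
  choose F u hu using key
  exact isConvergent_of_isIso_yonedaMap M F u hu
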